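/- Let $\mathbb N^{\mathbb N}$ be Baire space. A partial function $F:\subseteq\mathbb N^{\mathbb N}\to\mathbb N^{\mathbb N}$ is computable if some oracle machine computes $F(p)(n)$ from $n$ with oracle $p$, for all $p\in\mathrm{dom}(F)$ and $n\in\mathbb N$. A represented space is a set $X$ with a surjective partial map $\delta_X:\subseteq\mathbb N^{\mathbb N}\to X$; if $\delta_X(p)=x$, then $p$ is called a name of $x$. A realizer of a partial multi-valued function $f:\subseteq X\rightrightarrows Y$ between represented spaces is a partial function $F:\subseteq\mathbb N^{\mathbb N}\to\mathbb N^{\mathbb N}$ with $\delta_Y(F(p))\in f(\delta_X(p))$ for all $p$ that are names of points in $\mathrm{dom}(f)$. One says that $f$ is Weihrauch reducible to $g$, in symbols $f\leq_{\mathrm W}g$, if there are computable partial functions $H,K:\subseteq\mathbb N^{\mathbb N}\to\mathbb N^{\mathbb N}$ such that $p\mapsto H\langle p,G(K(p))\rangle$ is a realizer of $f$ for every realizer $G$ of $g$, where $\langle p,q\rangle(2n)=p(n)$ and $\langle p,q\rangle(2n+1)=q(n)$. Let $\mathcal A_-(X)$ denote the set of closed subsets of $X$, represented by negative information: a name of $A\subseteq\mathbb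 N$ is a sequence $p$ with $\mathbb N\setminus A=\{n: n+1\in\mathrm{range}(p)\}$, and a name of a closed set $A\subseteq[0,1]$ is (a code of) a sequence of open balls of $[0,1]$ with rational centers and rational radii whose union is $[0,1]\setminus A$. The only name of $n\in\mathbb N$ is the constant sequence with value $n$, and a name of $x\in[0,1]$ is (a code of) a sequence $(q_n)$ of rational numbers in $[0,1]$ that converges to $x$ with $|q_i-q_j|\leq 2^{-i}$ for all $i<j$. Discrete choice is the multi-valued function $C_{\mathbb N}:\subseteq\mathcal A_-(\mathbb N)\rightrightarrows\mathbb N$, $A\mapsto A$, with domain $\{A\subseteq\mathbb N: A\neq\emptyset\}$. Interval choice is the multi-valued function $C_{\mathrm I}:\subseteq\mathcal A_-([0,1])\rightrightarrows[0,1]$, $A\mapsto A$, with domain $\{[a,b]:0\leq a\leq b\leq 1\}$. Then $C_{\mathrm I}\not\leq_{\mathrm W}C_{\mathbb N}$. Moreover, $C_{\mathbb N}\not\leq_{\mathrm W}C_{\mathrm I}$, so that $C_{\mathbb N}$ and $C_{\mathrm I}$ are incomparable with respect to Weihrauch reducibility. -/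

import Mathlib

open Filter Topology

/-- Baire space `ℕ^ℕ`. -/
abbrev BaireSeq : Type := ℕ → ℕ

/-- The partial recursive functionals `Φ(p, n)` with a function argument `p : ℕ → ℕ` and a number
argument `n`: the functionals that are computed by oracle machines, where one and the same machine
works for all oracles `p`. The clauses are those of Kleene's partial recursive functions (as in
`Nat.Partrec`), plus access to the oracle. -/
inductive PartrecFunctional : (BaireSeq → ℕ →. ℕ) → Prop
  | zero : PartrecFunctional fun _ _ => Part.some 0
  | succ : PartrecFunctional fun _ n => Part.some (n + 1)
  | left : PartrecFunctional fun _ n => Part.some n.unpair.1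
  | right : PartrecFunctional fun _ n => Part.some n.unpair.2
  | oracle : PartrecFunctional fun p n => Part.some (p n)
  | pair {Φ Ψ : BaireSeq → ℕ →. ℕ} (hΦ : PartrecFunctional Φ) (hΨ : PartrecFunctional Ψ) :
      PartrecFunctional fun p n => Nat.pair <$> Φ p n <*> Ψ p n
  | comp {Φ Ψ : BaireSeq → ℕ →. ℕ} (hΦ : PartrecFunctional Φ) (hΨ : PartrecFunctional Ψ) :
      PartrecFunctional fun p n => Ψ p n >>= Φ p
  | prec {Φ Ψ : BaireSeq → ℕ →. ℕ} (hΦ : PartrecFunctional Φ) (hΨ : PartrecFunctional Ψ) :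
      PartrecFunctional fun p => Nat.unpaired fun a n =>
        n.rec (Φ p a) fun y IH => do
          let i ← IH
          Ψ p (Nat.pair a (Nat.pair y i))
  | rfind {Φ : BaireSeq → ℕ →. ℕ} (hΦ : PartrecFunctional Φ) :
      PartrecFunctional fun p a =>
        Nat.rfind fun n => (fun m => decide (m = 0)) <$> Φ p (Nat.pair a n)

/-- A partial function `F :⊆ ℕ^ℕ → ℕ^ℕ` is computable if some oracle machine computes, for every
`p` in the domain of `F`, the value `F(p)(n)` on oracle `p` and input `n`. (As usual, nothing is
required of the machine outside the domain of `F`.) -/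
def IsComputableOnBaire (F : BaireSeq →. BaireSeq) : Prop :=
  ∃ Φ : BaireSeq → ℕ →. ℕ, PartrecFunctional Φ ∧ ∀ p, ∀ q ∈ F p, ∀ n, q n ∈ Φ p n

/-- The standard pairing `⟨p, q⟩` on Baire space: `p` on the even and `q` on the odd places. -/
def bairePair (p q : BaireSeq) : BaireSeq :=
  fun n => if n % 2 = 0 then p (n / 2) else q (n / 2)

/-- The partial function `H⟨id, G K⟩`, defined at `p` if `K(p)`, `G(K(p))` and
`H⟨p, G(K(p))⟩` are all defined. -/
def weihrauchComp (H G K : BaireSeq →. BaireSeq) : BaireSeq →. BaireSeq :=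
  fun p => (K p).bind fun k => (G k).bind fun g => H (bairePair p g)

/-- Weihrauch reducibility of sets of partial functions on Baire space. -/
def SetWeihrauchReducible (𝓕 𝓖 : Set (BaireSeq →. BaireSeq)) : Prop :=
  ∃ H K : BaireSeq →. BaireSeq, IsComputableOnBaire H ∧ IsComputableOnBaire K ∧
    ∀ G ∈ 𝓖, ∃ F ∈ 𝓕, F = weihrauchComp H G K

/-- A represented space: a set `X` with a surjective partial map `δ :⊆ ℕ^ℕ → X`, given by its
graph; `IsName p x` says that `δ(p) = x`. -/
class RepresentedSpace (X : Type*) where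
  IsName : BaireSeq → X → Prop
  functional : ∀ {p x y}, IsName p x → IsName p y → x = y
  surjective : ∀ x, ∃ p, IsName p x

open RepresentedSpace (IsName)

/-- A partial multi-valued function `f :⊆ X ⇉ Y`, given by its sets of values; its domain consists
of the points where the set of values is non-empty. -/
abbrev MultiFun (X Y : Type*) : Type _ := X → Set Y

/-- `F` is a realizer of `f`: `F(p)` exists and is a name of a value in `f(x)`, whenever `p` is a
name of a point `x` in the domain of `f`. -/
def IsRealizer {X Y : Type*} [RepresentedSpace X] [RepresentedSpace Y]
    (F : BaireSeq →. BaireSeq) (f : MultiFun X Y) : Prop :=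
  ∀ p x, IsName p x → (f x).Nonempty → ∃ q ∈ F p, ∃ y ∈ f x, IsName q y

/-- Weihrauch reducibility `f ≤_W g` of multi-valued functions on represented spaces. -/
def WeihrauchReducible {X Y U V : Type*} [RepresentedSpace X] [RepresentedSpace Y]
    [RepresentedSpace U] [RepresentedSpace V] (f : MultiFun X Y) (g : MultiFun U V) : Prop :=
  SetWeihrauchReducible {F | IsRealizer F f} {G | IsRealizer G g}

/-- The representation of `ℕ` in which the constant sequence with value `n` is the only name
of `n`. -/
instance natRepresented : RepresentedSpace ℕ where
  IsName p n := p = fun _ => n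
  functional h h' := congrFun (h.symm.trans h') 0
  surjective n := ⟨fun _ => n, rfl⟩

/-- The negative information representation of the (closed) subsets of `ℕ`: `p` is a name of `A` if
`p` enumerates the complement of `A`, shifted by one. -/
instance closedsNatRepresented : RepresentedSpace (TopologicalSpace.Closeds ℕ) where
  IsName p A := ∀ n, n ∉ A ↔ ∃ k, p k = n + 1
  functional {p A B} hA hB := by
    ext n
    exact not_iff_not.mp ((hA n).trans (hB n).symm)
  surjective A := by
    classical
    refine ⟨fun k => if k ∉ A then k + 1 else 0, fun n => ⟨fun h => ⟨n, if_pos h⟩, ?_⟩⟩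
    rintro ⟨k, hk⟩
    beta_reduce at hk
    by_cases h : k ∉ A
    · rw [if_pos h] at hk
      exact (Nat.succ.inj hk) ▸ h
    · rw [if_neg h] at hk
      exact absurd hk (Nat.succ_ne_zero n).symm

/-- The standard numbering of the rational numbers, `⟨⟨i, j⟩, k⟩ ↦ (i - j) / (k + 1)`. -/
def ratNumbering (n : ℕ) : ℚ :=
  ((n.unpair.1.unpair.1 : ℚ) - (n.unpair.1.unpair.2 : ℚ)) / ((n.unpair.2 : ℚ) + 1)

theorem ratNumbering_surjective : Function.Surjective ratNumbering := by
  intro q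
  refine ⟨Nat.pair (Nat.pair q.num.toNat (-q.num).toNat) (q.den - 1), ?_⟩
  have h1 : ((q.num.toNat : ℚ) - ((-q.num).toNat : ℚ)) = q.num := by
    have := Int.toNat_sub_toNat_neg q.num
    exact_mod_cast congrArg (Int.cast : ℤ → ℚ) this
  have h2 : (((q.den - 1 : ℕ) : ℚ) + 1) = q.den := by
    have := Nat.sub_add_cancel q.pos
    exact_mod_cast congrArg (Nat.cast : ℕ → ℚ) this
  simp only [ratNumbering, Nat.unpair_pair, h1, h2]
  exact Rat.num_div_den q

theorem ratNumbering_zero : ratNumbering 0 = 0 := by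
  simp [ratNumbering]

/-- The rational open ball of a metric space with dense sequence `α` that has the code `⟨i, j⟩`: the
ball with centre `α i` and rational radius number `j` (it is empty if that radius is not
positive). -/
def ratBall {X : Type*} [MetricSpace X] (α : ℕ → X) (c : ℕ) : Set X :=
  Metric.ball (α c.unpair.1) (ratNumbering c.unpair.2 : ℝ)

/-- The Cauchy representation of a separable metric space with dense sequence `α`: names are
rapidly converging sequences in the dense set. -/
abbrev cauchyRepresentation {X : Type*} [MetricSpace X] (α : ℕ → X) (hα : DenseRange α) :
    RepresentedSpace X where
  IsName p x := (∀ i j, i < j → dist (α (p i)) (α (p j)) ≤ (1 / 2 : ℝ) ^ i) ∧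
    Tendsto (fun n => α (p n)) atTop (𝓝 x)
  functional h h' := tendsto_nhds_unique h.2 h'.2
  surjective x := by
    have key : ∀ n : ℕ, ∃ k, dist x (α k) < (1 / 2 : ℝ) ^ (n + 1) := fun n =>
      hα.exists_dist_lt x (by positivity)
    choose p hp using key
    refine ⟨p, fun i j hij => ?_, ?_⟩
    · have h1 := hp i
      have h2 := hp j
      have h3 : (1 / 2 : ℝ) ^ (j + 1) ≤ (1 / 2 : ℝ) ^ (i + 1) :=
        pow_le_pow_of_le_one (by norm_num) (by norm_num) (by omega)
      have h4 := dist_triangle_left (α (p i)) (α (p j)) x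
      have h5 : (1 / 2 : ℝ) ^ (i + 1) = (1 / 2 : ℝ) ^ i / 2 := by ring
      linarith
    · rw [tendsto_iff_dist_tendsto_zero]
      have h0 : Tendsto (fun n : ℕ => (1 / 2 : ℝ) ^ (n + 1)) atTop (𝓝 0) :=
        (tendsto_pow_atTop_nhds_zero_of_lt_one (by norm_num) (by norm_num)).comp
          (tendsto_add_atTop_nat 1)
      refine squeeze_zero (fun _ => dist_nonneg) (fun n => ?_) h0
      rw [dist_comm]
      exact (hp n).le

/-- The negative information representation of the closed subsets of a separable metric space with
dense sequence `α`: `p` is a name of `A` if it enumerates rational open balls whose union is the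
complement of `A`. -/
abbrev negativeRepresentation {X : Type*} [MetricSpace X] (α : ℕ → X) (hα : DenseRange α) :
    RepresentedSpace (TopologicalSpace.Closeds X) where
  IsName p A := (A : Set X)ᶜ = ⋃ n, ratBall α (p n)
  functional h h' := TopologicalSpace.Closeds.ext (compl_injective (h.trans h'.symm))
  surjective A := by
    classical
    refine ⟨fun n => if ratBall α n ⊆ (A : Set X)ᶜ then n else 0, Set.Subset.antisymm ?_ ?_⟩
    · intro x hx
      obtain ⟨ε, hε, hball⟩ := Metric.isOpen_iff.mp A.isClosed.isOpen_compl x hx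
      obtain ⟨q, hq0, hqε⟩ := exists_rat_btwn (half_pos hε)
      obtain ⟨i, hi⟩ := hα.exists_dist_lt x hq0
      obtain ⟨j, hj⟩ := ratNumbering_surjective q
      have hc : ratBall α (Nat.pair i j) = Metric.ball (α i) (q : ℝ) := by
        simp [ratBall, hj]
      have hsub : ratBall α (Nat.pair i j) ⊆ (A : Set X)ᶜ := by
        rw [hc]
        intro y hy
        apply hball
        have h1 : dist y (α i) < q := hy
        have h2 := dist_triangle_right y x (α i)
        have : dist y x < ε := by linarith
        exact this
      refine Set.mem_iUnion.mpr ⟨Nat.pair i j, ?_⟩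
      beta_reduce
      rw [if_pos hsub, hc]
      exact hi
    · refine Set.iUnion_subset fun n => ?_
      beta_reduce
      by_cases h : ratBall α n ⊆ (A : Set X)ᶜ
      · rwa [if_pos h]
      · rw [if_neg h]
        simp [ratBall, ratNumbering_zero]

/-- The dense sequence of the rational numbers in `[0,1]` (numbers outside are moved to the nearer
endpoint). -/
noncomputable def unitIntervalSeq (n : ℕ) : unitInterval :=
  Set.projIcc (0 : ℝ) 1 zero_le_one (ratNumbering n : ℝ)

theorem denseRange_unitIntervalSeq : DenseRange unitIntervalSeq := by
  have h1 : DenseRange fun n => (ratNumbering n : ℝ) :=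
    (Rat.denseRange_cast (𝕜 := ℝ)).comp ratNumbering_surjective.denseRange
      Rat.continuous_coe_real
  exact (Set.projIcc_surjective (zero_le_one (α := ℝ))).denseRange.comp h1
    continuous_projIcc

noncomputable instance unitIntervalRepresented : RepresentedSpace unitInterval :=
  cauchyRepresentation unitIntervalSeq denseRange_unitIntervalSeq

noncomputable instance closedsUnitIntervalRepresented :
    RepresentedSpace (TopologicalSpace.Closeds unitInterval) :=
  negativeRepresentation unitIntervalSeq denseRange_unitIntervalSeq

/-- The choice map `A ↦ A`, restricted to the non-empty closed sets in the class `D`. -/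
def choiceOn {X : Type*} [TopologicalSpace X] (D : Set (TopologicalSpace.Closeds X)) :
    MultiFun (TopologicalSpace.Closeds X) X :=
  fun A => {x | A ∈ D ∧ x ∈ A}

/-- Discrete choice `C_ℕ`: given a non-empty `A ⊆ ℕ` by negative information, find a member. -/
def discreteChoice : MultiFun (TopologicalSpace.Closeds ℕ) ℕ :=
  choiceOn {A | (A : Set ℕ).Nonempty}

/-- Interval choice `C_I`: given a closed interval `[a,b]` with `0 ≤ a ≤ b ≤ 1` by negative
information, find a member. -/
def intervalChoice : MultiFun (TopologicalSpace.Closeds unitInterval) unitInterval :=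
  choiceOn {A | ∃ a b : unitInterval, a ≤ b ∧ (A : Set unitInterval) = Set.Icc a b}

/-! A halting oracle computation reads only finitely much of its oracle
(`PartrecFunctional.eventually_mem`), so both non-reductions are topological.

For `C_I ≰ C_ℕ`, take intervals in `[0,1]` whose names depend continuously on `s : ℕ → Fin 3`. A
reduction turns them into non-empty sets `A s ⊆ ℕ`; each `{s | n ∈ A s}` is closed and together they
cover the parameter space. By Baire, one `n` is a correct answer on a non-empty open set, where `H`
with this fixed answer would select points of the intervals continuously. But a finite prefix of `s`
always leaves open whether the interval shrinks to its left or its right third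
(`not_continuous_intervalChoice`).

For `C_ℕ ≰ C_I`, compactness of `[0,1]` is decisive. Names of `{n | M < n}` converge to a name of
`ℕ`, and solutions of the associated interval instances subconverge to a solution of the limit
instance. There `H` answers some `m` after finitely many steps, hence gives the same answer for some
`M ≥ m`, where it is wrong. -/

/-! ### Continuity of oracle computations -/

theorem eventually_apply_eq {α : Type*} [TopologicalSpace α] [DiscreteTopology α] (s : ℕ → α)
    (k : ℕ) : ∀ᶠ t in 𝓝 s, t k = s k :=
  (continuous_apply k).continuousAt.eventually ((isOpen_discrete {s k}).mem_nhds rfl)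

/-- Induction on the functional: each clause, including a successful search, combines finitely many
halting computations, and finite intersections of neighbourhoods are neighbourhoods. -/
theorem PartrecFunctional.eventually_mem {Φ : BaireSeq → ℕ →. ℕ} (hΦ : PartrecFunctional Φ) :
    ∀ {p : BaireSeq} {n m : ℕ}, m ∈ Φ p n → ∀ᶠ p' in 𝓝 p, m ∈ Φ p' n := by
  induction hΦ with
  | zero => exact fun h => Eventually.of_forall fun _ => h
  | succ => exact fun h => Eventually.of_forall fun _ => h
  | left => exact fun h => Eventually.of_forall fun _ => h
  | right => exact fun h => Eventually.of_forall fun _ => h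
  | oracle =>
    intro p n m h
    rw [Part.mem_some_iff] at h
    filter_upwards [eventually_apply_eq p n] with p' hp'
    rw [Part.mem_some_iff, h, hp']
  | pair _ _ ihΦ ihΨ =>
    intro p n m h
    obtain ⟨g, hg, hm⟩ := Part.mem_bind_iff.mp h
    obtain ⟨a, ha, rfl⟩ := (Part.mem_map_iff _).mp hg
    obtain ⟨b, hb, rfl⟩ := (Part.mem_map_iff _).mp hm
    filter_upwards [ihΦ ha, ihΨ hb] with p' h1 h2
    exact Part.mem_bind_iff.mpr ⟨_, Part.mem_map _ h1, Part.mem_map _ h2⟩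
  | comp _ _ ihΦ ihΨ =>
    intro p n m h
    obtain ⟨a, ha, hb⟩ := Part.mem_bind_iff.mp h
    filter_upwards [ihΨ ha, ihΦ hb] with p' h1 h2
    exact Part.mem_bind_iff.mpr ⟨a, h1, h2⟩
  | prec _ _ ihΦ ihΨ =>
    intro p n m h
    simp only [Nat.unpaired] at h ⊢
    generalize n.unpair.1 = a at h ⊢
    generalize n.unpair.2 = k at h ⊢
    induction k generalizing m with
    | zero => exact ihΦ h
    | succ k ih =>
      simp only [Part.bind_eq_bind, Part.mem_bind_iff] at h ⊢
      obtain ⟨i, hi, hm⟩ := h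
      filter_upwards [ih hi, ihΨ hm] with p' h1 h2
      exact ⟨i, h1, h2⟩
  | rfind _ ihΦ =>
    intro p n m h
    obtain ⟨h0, hlt⟩ := Nat.mem_rfind.mp h
    obtain ⟨a, ha, ha0⟩ := (Part.mem_map_iff _).mp h0
    have hall := (eventually_all_finite (Set.finite_Iio m)).mpr fun k hk => by
      obtain ⟨b, hb, hb0⟩ := (Part.mem_map_iff _).mp (hlt hk)
      exact (ihΦ hb).mono fun p' hp' => (Part.mem_map_iff _).mpr ⟨b, hp', hb0⟩
    filter_upwards [ihΦ ha, hall] with p' h1 h2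
    exact Nat.mem_rfind.mpr ⟨(Part.mem_map_iff _).mpr ⟨a, h1, ha0⟩, fun hk => h2 _ hk⟩

/-! ### Unpacking a reduction -/

/-- A reduction `f ≤_W g` yields oracle functionals for `H` and `K`, such that `K` maps names of
points of `dom f` to names of points of `dom g`, and `H` maps every name of every solution of the
resulting instance of `g` to a name of a solution of `f`. -/
theorem WeihrauchReducible.exists_functionals {X Y U V : Type*} [RepresentedSpace X]
    [RepresentedSpace Y] [RepresentedSpace U] [RepresentedSpace V] {f : MultiFun X Y}
    {g : MultiFun U V} (h : WeihrauchReducible f g) :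
    ∃ Φ Ψ : BaireSeq → ℕ →. ℕ, PartrecFunctional Φ ∧ PartrecFunctional Ψ ∧
      ∀ p x, IsName p x → (f x).Nonempty → ∃ k u, (∀ n, k n ∈ Ψ p n) ∧ IsName k u ∧
        (g u).Nonempty ∧ ∀ v ∈ g u, ∀ q, IsName q v →
          ∃ r y, (∀ n, r n ∈ Φ (bairePair p q) n) ∧ y ∈ f x ∧ IsName r y := by
  classical
  obtain ⟨H, K, ⟨Φ, hΦ, hH⟩, ⟨Ψ, hΨ, hK⟩, hred⟩ := h
  refine ⟨Φ, Ψ, hΦ, hΨ, fun p x hp hx => ?_⟩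
  have realizes : ∀ G, IsRealizer G g → IsRealizer (weihrauchComp H G K) f := by
    intro G hG
    obtain ⟨F, hF, rfl⟩ := hred G hG
    exact hF
  let S : BaireSeq → BaireSeq → Prop := fun k q => ∃ u, IsName k u ∧ ∃ v ∈ g u, IsName q v
  -- `G₀` is undefined off the names of points of `dom g`, so definedness of the composite at `p`
  -- forces `K p` to be such a name.
  let G₀ : BaireSeq →. BaireSeq := fun k => ⟨∃ q, S k q, fun hk => hk.choose⟩
  have hG₀ : ∀ k q, q ∈ G₀ k → S k q := by
    rintro k q ⟨hk, rfl⟩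
    exact hk.choose_spec
  have hG₀r : IsRealizer G₀ g := by
    rintro k u hk ⟨v, hv⟩
    obtain ⟨q, hq⟩ := RepresentedSpace.surjective v
    have hd : ∃ q, S k q := ⟨q, u, hk, v, hv, hq⟩
    obtain ⟨u', hu', v', hv', hn⟩ := hd.choose_spec
    cases RepresentedSpace.functional hk hu'
    exact ⟨hd.choose, ⟨hd, rfl⟩, v', hv', hn⟩
  obtain ⟨r₀, hr₀, -⟩ := realizes G₀ hG₀r p x hp hx
  simp only [weihrauchComp, Part.mem_bind_iff] at hr₀
  obtain ⟨k, hk, q₀, hq₀, -⟩ := hr₀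
  obtain ⟨u, hu, v₀, hv₀, -⟩ := hG₀ k q₀ hq₀
  refine ⟨k, u, hK p k hk, hu, ⟨v₀, hv₀⟩, fun v hv q hq => ?_⟩
  -- Changing the realizer at the single name `k` makes it return any prescribed name `q` of a
  -- solution.
  let G : BaireSeq →. BaireSeq := fun k' => if k' = k then Part.some q else G₀ k'
  have hGr : IsRealizer G g := by
    intro k' u' hk' hu'
    by_cases hkk : k' = k
    · subst hkk
      cases RepresentedSpace.functional hk' hu
      exact ⟨q, by simp [G], v, hv, hq⟩
    · simpa [G, hkk] using hG₀r k' u' hk' hu'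
  obtain ⟨r, hr, y, hy, hry⟩ := realizes G hGr p x hp hx
  simp only [weihrauchComp, Part.mem_bind_iff] at hr
  obtain ⟨k', hk', q', hq', hr⟩ := hr
  cases Part.mem_unique hk hk'
  obtain rfl : q' = q := by simpa [G] using hq'
  exact ⟨r, y, hH _ r hr, hy, hry⟩

/-! ### Convergence of names -/

theorem tendsto_bairePair {ι : Type*} {l : Filter ι} {p q : ι → BaireSeq} {p₀ q₀ : BaireSeq}
    (hp : Tendsto p l (𝓝 p₀)) (hq : Tendsto q l (𝓝 q₀)) :
    Tendsto (fun i => bairePair (p i) (q i)) l (𝓝 (bairePair p₀ q₀)) := by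
  rw [tendsto_pi_nhds] at *
  intro n
  by_cases hn : n % 2 = 0
  · simpa [bairePair, hn] using hp (n / 2)
  · simpa [bairePair, hn] using hq (n / 2)

theorem unitInterval.dist_le_of_isName {q : BaireSeq} {x : unitInterval} (hq : IsName q x)
    (i : ℕ) : dist (unitIntervalSeq (q i)) x ≤ (1 / 2 : ℝ) ^ i :=
  le_of_tendsto (tendsto_const_nhds.dist hq.2)
    ((eventually_gt_atTop i).mono fun j hj => hq.1 i j hj)

theorem unitInterval.isName_of_dist_le {q : BaireSeq} {x : unitInterval}
    (hq : ∀ i, dist (unitIntervalSeq (q i)) x ≤ (1 / 2 : ℝ) ^ (i + 1)) : IsName q x := by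
  refine ⟨fun i j hij => ?_, ?_⟩
  · have h3 : (1 / 2 : ℝ) ^ (j + 1) ≤ (1 / 2 : ℝ) ^ (i + 1) :=
      pow_le_pow_of_le_one (by norm_num) (by norm_num) (by omega)
    have h4 := dist_triangle_right (unitIntervalSeq (q i)) (unitIntervalSeq (q j)) x
    have h5 : (1 / 2 : ℝ) ^ (i + 1) = (1 / 2 : ℝ) ^ i / 2 := by ring
    linarith [hq i, hq j]
  · rw [tendsto_iff_dist_tendsto_zero]
    have h0 : Tendsto (fun n : ℕ => (1 / 2 : ℝ) ^ (n + 1)) atTop (𝓝 0) :=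
      (tendsto_pow_atTop_nhds_zero_of_lt_one (by norm_num) (by norm_num)).comp
        (tendsto_add_atTop_nat 1)
    exact squeeze_zero (fun _ => dist_nonneg) hq h0

/-- Convergent sequences in `[0,1]` can be lifted to convergent sequences of names. -/
theorem unitInterval.exists_tendsto_names {x : ℕ → unitInterval} {x₀ : unitInterval}
    (hx : Tendsto x atTop (𝓝 x₀)) :
    ∃ (q : ℕ → BaireSeq) (q₀ : BaireSeq), (∀ k, IsName (q k) (x k)) ∧ IsName q₀ x₀ ∧
      Tendsto q atTop (𝓝 q₀) := by
  classical
  have key : ∀ (y : unitInterval) (i : ℕ),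
      ∃ c, dist (unitIntervalSeq c) y < (1 / 2 : ℝ) ^ (i + 1) := fun y i => by
    obtain ⟨c, hc⟩ := denseRange_unitIntervalSeq.exists_dist_lt y
      (ε := (1 / 2 : ℝ) ^ (i + 1)) (by positivity)
    exact ⟨c, by rwa [dist_comm]⟩
  choose c hc using key
  -- Reuse the digit of the limit's name whenever it is accurate enough for `x k`; as the bound is
  -- strict, this holds for each fixed `i` and all large `k`.
  refine ⟨fun k i => if dist (unitIntervalSeq (c x₀ i)) (x k) < (1 / 2 : ℝ) ^ (i + 1)
    then c x₀ i else c (x k) i, c x₀, fun k => isName_of_dist_le fun i => ?_,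
    isName_of_dist_le fun i => (hc x₀ i).le, ?_⟩
  · beta_reduce
    split_ifs with h
    · exact h.le
    · exact (hc _ _).le
  · rw [tendsto_pi_nhds]
    intro i
    have hlt := (tendsto_const_nhds.dist hx).eventually_lt_const (hc x₀ i)
    refine tendsto_const_nhds.congr' ?_
    filter_upwards [hlt] with k hk
    rw [if_pos hk]

/-! ### Compactness argument -/

/-- Discrete choice is not reducible to interval choice. -/
theorem not_discreteChoice_le_intervalChoice :
    ¬ WeihrauchReducible discreteChoice intervalChoice := by
  intro hred
  obtain ⟨Φ, Ψ, hΦ, hΨ, h⟩ := hred.exists_functionals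
  -- After `M` zeros, `p M` removes exactly the numbers `0, …, M`; the delay gives convergence to
  -- the zero sequence.
  let p : ℕ → BaireSeq := fun M k => if M ≤ k ∧ k ≤ 2 * M then k - M + 1 else 0
  have hp : Tendsto p atTop (𝓝 fun _ => 0) := by
    rw [tendsto_pi_nhds]
    intro k
    refine tendsto_const_nhds.congr' ?_
    filter_upwards [eventually_gt_atTop k] with M hM
    simp only [p]
    rw [if_neg (by omega)]
  have hpname : ∀ M, IsName (p M) (⟨Set.Ioi M, isClosed_discrete _⟩ : TopologicalSpace.Closeds ℕ) := by
    intro M n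
    change ¬ M < n ↔ ∃ k, (if M ≤ k ∧ k ≤ 2 * M then k - M + 1 else 0) = n + 1
    constructor
    · exact fun hn => ⟨n + M, by rw [if_pos (by omega)]; omega⟩
    · rintro ⟨k, hk⟩
      split_ifs at hk
      omega
  have h0name : IsName (fun _ => 0 : BaireSeq) (⊤ : TopologicalSpace.Closeds ℕ) := by
    intro n
    have : n ∈ (⊤ : TopologicalSpace.Closeds ℕ) := trivial
    simp [this]
  obtain ⟨k₀, J₀, hk₀, hJ₀, ⟨z, ⟨hz, -⟩⟩, hH₀⟩ := h _ _ h0name ⟨0, ⟨0, trivial⟩, trivial⟩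
  have hM := fun M => h _ _ (hpname M) ⟨M + 1, ⟨M + 1, Nat.lt_succ_self M⟩, Nat.lt_succ_self M⟩
  choose k J hk hJ hJne hH using hM
  choose x hx using hJne
  obtain ⟨x₀, -, φ, hφ, hlim⟩ := isCompact_univ.tendsto_subseq (x := x) fun _ => Set.mem_univ _
  obtain ⟨q, q₀, hq, hq₀, hqlim⟩ := unitInterval.exists_tendsto_names hlim
  have hpφ := hp.comp hφ.tendsto_atTop
  -- Otherwise a ball listed by `k₀` contains `x₀`; for large `i` the same ball is listed by `k (φ
  -- i)` and contains `x (φ i)`.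
  have hx₀ : x₀ ∈ J₀ := by
    by_contra hn
    have hn' : x₀ ∈ (J₀ : Set unitInterval)ᶜ := hn
    rw [show (J₀ : Set unitInterval)ᶜ = _ from hJ₀] at hn'
    obtain ⟨j, hj⟩ := Set.mem_iUnion.mp hn'
    have h1 := hpφ.eventually (hΨ.eventually_mem (hk₀ j))
    have h2 : ∀ᶠ i in atTop, (x ∘ φ) i ∈ ratBall unitIntervalSeq (k₀ j) :=
      hlim.eventually (Metric.isOpen_ball.mem_nhds hj)
    obtain ⟨i, hi1, hi2⟩ := (h1.and h2).exists
    rw [Part.mem_unique hi1 (hk (φ i) j)] at hi2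
    have : x (φ i) ∈ (J (φ i) : Set unitInterval)ᶜ := by
      rw [show (J (φ i) : Set unitInterval)ᶜ = _ from hJ (φ i)]
      exact Set.mem_iUnion.mpr ⟨j, hi2⟩
    exact this (hx (φ i)).2
  obtain ⟨r₀, m, hr₀, -, rfl⟩ := hH₀ x₀ ⟨hz, hx₀⟩ q₀ hq₀
  have h1 := (tendsto_bairePair hpφ hqlim).eventually (hΦ.eventually_mem (hr₀ 0))
  obtain ⟨i, hi, him⟩ := (h1.and (hφ.tendsto_atTop.eventually_ge_atTop m)).exists
  obtain ⟨r, m', hr, ⟨-, hm'⟩, rfl⟩ := hH (φ i) (x (φ i)) (hx (φ i)) (q i) (hq i)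
  have hmm := Part.mem_unique hi (hr 0)
  have hlt : φ i < m' := hm'
  simp only at hmm
  omega

/-! ### A continuous family of intervals -/

/-- Nested intervals in `[0,1]`, given by their endpoints: in every step one keeps the interval or
passes to its left or right third. -/
def nestedThirds (s : ℕ → Fin 3) : ℕ → ℚ × ℚ
  | 0 => (0, 1)
  | k + 1 =>
    let I := nestedThirds s k
    if s k = 0 then I
    else if s k = 1 then (I.1, (2 * I.1 + I.2) / 3)
    else ((I.1 + 2 * I.2) / 3, I.2)

theorem nestedThirds_lt (s : ℕ → Fin 3) (k : ℕ) : (nestedThirds s k).1 < (nestedThirds s k).2 := by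
  induction k with
  | zero => simp [nestedThirds]
  | succ k ih =>
    simp only [nestedThirds]
    split_ifs <;> linarith

theorem nestedThirds_monotone_fst (s : ℕ → Fin 3) : Monotone fun k => (nestedThirds s k).1 := by
  refine monotone_nat_of_le_succ fun k => ?_
  have := nestedThirds_lt s k
  rw [nestedThirds]
  split_ifs <;> linarith

theorem nestedThirds_antitone_snd (s : ℕ → Fin 3) : Antitone fun k => (nestedThirds s k).2 := by
  refine antitone_nat_of_succ_le fun k => ?_
  have := nestedThirds_lt s k
  rw [nestedThirds]
  split_ifs <;> linarith

theorem nestedThirds_nonneg (s : ℕ → Fin 3) (k : ℕ) : 0 ≤ (nestedThirds s k).1 :=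
  nestedThirds_monotone_fst s (Nat.zero_le k)

theorem nestedThirds_le_one (s : ℕ → Fin 3) (k : ℕ) : (nestedThirds s k).2 ≤ 1 :=
  nestedThirds_antitone_snd s (Nat.zero_le k)

theorem nestedThirds_fst_le_snd (s : ℕ → Fin 3) (i j : ℕ) :
    (nestedThirds s i).1 ≤ (nestedThirds s j).2 :=
  (nestedThirds_monotone_fst s (le_max_left i j)).trans
    ((nestedThirds_lt s _).le.trans (nestedThirds_antitone_snd s (le_max_right i j)))

theorem nestedThirds_congr {s t : ℕ → Fin 3} {k : ℕ} (h : ∀ i < k, s i = t i) :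
    nestedThirds s k = nestedThirds t k := by
  induction k with
  | zero => rfl
  | succ k ih =>
    rw [nestedThirds, nestedThirds, ih fun i hi => h i (by omega), h k (by omega)]

theorem eventually_nestedThirds_eq (s : ℕ → Fin 3) (k : ℕ) :
    ∀ᶠ t in 𝓝 s, nestedThirds t k = nestedThirds s k := by
  have h : ∀ᶠ t : ℕ → Fin 3 in 𝓝 s, ∀ i ∈ Set.Iio k, t i = s i :=
    (eventually_all_finite (Set.finite_Iio k)).mpr fun i _ =>
      eventually_apply_eq s i
  exact h.mono fun t ht => nestedThirds_congr ht

/-- The intersection of the intervals `nestedThirds s k`. -/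
def nestedThirdsInter (s : ℕ → Fin 3) : TopologicalSpace.Closeds unitInterval where
  carrier := {x | ∀ k, ((nestedThirds s k).1 : ℝ) ≤ x ∧ (x : ℝ) ≤ (nestedThirds s k).2}
  isClosed' := by
    simp only [Set.ofPred_forall, Set.ofPred_and]
    exact isClosed_iInter fun k =>
      (isClosed_le continuous_const continuous_subtype_val).inter
        (isClosed_le continuous_subtype_val continuous_const)

theorem nestedThirdsInter_eq_Icc (s : ℕ → Fin 3) :
    ∃ a b : unitInterval, a ≤ b ∧ (nestedThirdsInter s : Set unitInterval) = Set.Icc a b := by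
  have h0 : ∀ k, (0 : ℝ) ≤ (nestedThirds s k).1 := fun k => by
    exact_mod_cast nestedThirds_nonneg s k
  have h1 : ∀ k, ((nestedThirds s k).2 : ℝ) ≤ 1 := fun k => by
    exact_mod_cast nestedThirds_le_one s k
  have hle : ∀ i j, ((nestedThirds s i).1 : ℝ) ≤ (nestedThirds s j).2 := fun i j => by
    exact_mod_cast nestedThirds_fst_le_snd s i j
  have ha : BddAbove (Set.range fun k => ((nestedThirds s k).1 : ℝ)) :=
    ⟨_, Set.forall_mem_range.mpr fun i => hle i 0⟩
  have hb : BddBelow (Set.range fun k => ((nestedThirds s k).2 : ℝ)) :=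
    ⟨_, Set.forall_mem_range.mpr fun i => hle 0 i⟩
  have hab : (⨆ k, ((nestedThirds s k).1 : ℝ)) ≤ ⨅ k, ((nestedThirds s k).2 : ℝ) :=
    ciSup_le fun i => le_ciInf fun j => hle i j
  have ha0 := (h0 0).trans (le_ciSup ha 0)
  have hb1 := (ciInf_le hb 0).trans (h1 0)
  refine ⟨⟨_, ha0, hab.trans hb1⟩, ⟨_, ha0.trans hab, hb1⟩, hab, ?_⟩
  ext x
  rw [Set.mem_Icc, ← Subtype.coe_le_coe, ← Subtype.coe_le_coe, ciSup_le_iff ha, le_ciInf_iff hb]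
  exact forall_and

/-- A code of a rational number with respect to `ratNumbering`. -/
noncomputable def ratCode (q : ℚ) : ℕ := Function.surjInv ratNumbering_surjective q

theorem ratNumbering_ratCode (q : ℚ) : ratNumbering (ratCode q) = q :=
  Function.surjInv_eq _ q

/-- A name of `nestedThirdsInter s`, which lists the complements of the intervals. -/
noncomputable def nestedThirdsName (s : ℕ → Fin 3) : BaireSeq :=
  -- In `[0,1]`, the balls about `0` of radius `a` and about `1` of radius `1 - b` are `[0,a)` and
  -- `(b,1]`, possibly empty.
  bairePair (fun k => Nat.pair (ratCode 0) (ratCode (nestedThirds s k).1))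
    fun k => Nat.pair (ratCode 1) (ratCode (1 - (nestedThirds s k).2))

theorem continuous_nestedThirdsName : Continuous nestedThirdsName := by
  refine continuous_iff_continuousAt.mpr fun s => tendsto_bairePair ?_ ?_ <;>
  · rw [tendsto_pi_nhds]
    refine fun k => tendsto_const_nhds.congr' ?_
    filter_upwards [eventually_nestedThirds_eq s k] with t ht
    rw [ht]

theorem mem_ratBall_left (a : ℚ) (x : unitInterval) :
    x ∈ ratBall unitIntervalSeq (Nat.pair (ratCode 0) (ratCode a)) ↔ (x : ℝ) < a := by
  simp [ratBall, unitIntervalSeq, ratNumbering_ratCode, Subtype.dist_eq,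
    abs_of_nonneg x.2.1]

theorem mem_ratBall_right (b : ℚ) (x : unitInterval) :
    x ∈ ratBall unitIntervalSeq (Nat.pair (ratCode 1) (ratCode (1 - b))) ↔ (b : ℝ) < x := by
  have h : |(x : ℝ) - 1| = 1 - x := by rw [abs_sub_comm, abs_of_nonneg (by linarith [x.2.2])]
  simp [ratBall, unitIntervalSeq, ratNumbering_ratCode, Subtype.dist_eq, Real.dist_eq, h]

theorem isName_nestedThirdsName (s : ℕ → Fin 3) :
    IsName (nestedThirdsName s) (nestedThirdsInter s) := by
  change (nestedThirdsInter s : Set unitInterval)ᶜ = ⋃ n, ratBall unitIntervalSeq _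
  ext x
  have hmem : x ∈ (nestedThirdsInter s : Set unitInterval)ᶜ ↔
      ∃ k, (x : ℝ) < (nestedThirds s k).1 ∨ ((nestedThirds s k).2 : ℝ) < x := by
    change ¬ (∀ k, _ ∧ _) ↔ _
    push Not
    refine exists_congr fun k => ?_
    rw [← not_le, ← not_le, imp_iff_not_or, not_le, not_le]
  rw [hmem, Set.mem_iUnion]
  constructor
  · rintro ⟨k, hk | hk⟩
    · refine ⟨2 * k, ?_⟩
      have h1 : 2 * k / 2 = k := by omega
      simpa [nestedThirdsName, bairePair, h1] using (mem_ratBall_left _ x).mpr hk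
    · refine ⟨2 * k + 1, ?_⟩
      have h1 : (2 * k + 1) / 2 = k := by omega
      have h2 : (2 * k + 1) % 2 ≠ 0 := by omega
      simpa only [nestedThirdsName, bairePair, if_neg h2, h1] using (mem_ratBall_right _ x).mpr hk
  · rintro ⟨n, hn⟩
    refine ⟨n / 2, ?_⟩
    by_cases h2 : n % 2 = 0
    · rw [nestedThirdsName, bairePair, if_pos h2] at hn
      exact Or.inl ((mem_ratBall_left _ x).mp hn)
    · rw [nestedThirdsName, bairePair, if_neg h2] at hn
      exact Or.inr ((mem_ratBall_right _ x).mp hn)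

/-! ### Absence of continuous selections -/

/-- The sequence that agrees with `s` below `M`, has value `j` at `M` and is zero afterwards. -/
def truncateWith (s : ℕ → Fin 3) (j : Fin 3) (M : ℕ) : ℕ → Fin 3 :=
  fun k => if k < M then s k else if k = M then j else 0

theorem tendsto_truncateWith (s : ℕ → Fin 3) (j : Fin 3) :
    Tendsto (truncateWith s j) atTop (𝓝 s) := by
  rw [tendsto_pi_nhds]
  intro k
  refine tendsto_const_nhds.congr' ?_
  filter_upwards [eventually_gt_atTop k] with M hM
  rw [truncateWith, if_pos hM]

theorem nestedThirds_truncateWith_zero (s : ℕ → Fin 3) {M k : ℕ} (hk : M ≤ k) :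
    nestedThirds (truncateWith s 0 M) k = nestedThirds s M := by
  induction k, hk using Nat.le_induction with
  | base => exact nestedThirds_congr fun i hi => if_pos hi
  | succ k hk ih =>
    have : truncateWith s 0 M k = 0 := by simp [truncateWith, Nat.not_lt.mpr hk]
    rw [nestedThirds, ih, if_pos this]

theorem nestedThirds_truncateWith_succ (s : ℕ → Fin 3) (j : Fin 3) (M : ℕ) :
    nestedThirds (truncateWith s j M) (M + 1) =
      if j = 0 then nestedThirds s M
      else if j = 1 then
        ((nestedThirds s M).1, (2 * (nestedThirds s M).1 + (nestedThirds s M).2) / 3)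
      else (((nestedThirds s M).1 + 2 * (nestedThirds s M).2) / 3, (nestedThirds s M).2) := by
  have h1 : truncateWith s j M M = j := by simp [truncateWith]
  have h2 : nestedThirds (truncateWith s j M) M = nestedThirds s M :=
    nestedThirds_congr fun i hi => if_pos hi
  rw [nestedThirds, h1, h2]

/-- Interval choice has no continuous realizer on a nonempty open set of parameters of nested
intervals. -/
theorem not_continuous_intervalChoice {U : Set (ℕ → Fin 3)} (hU : IsOpen U) (hne : U.Nonempty)
    {R : (ℕ → Fin 3) → BaireSeq} (hR : ContinuousOn R U) :
    ¬ ∀ s ∈ U, ∃ x ∈ nestedThirdsInter s, IsName (R s) x := by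
  intro h
  obtain ⟨s₀, hs₀⟩ := hne
  -- Along the truncation `s` the interval stays `[a,b]` from stage `N` on, so the precision `i` can
  -- be fixed before the perturbation stage `M`.
  obtain ⟨N, hN⟩ := ((tendsto_truncateWith s₀ 0).eventually (hU.mem_nhds hs₀)).exists
  set s := truncateWith s₀ 0 N with hs
  obtain ⟨a, b, hab⟩ : ∃ a b : ℚ, (a, b) = nestedThirds s₀ N := ⟨_, _, rfl⟩
  have hlt : (a : ℝ) < b := by
    have := nestedThirds_lt s₀ N
    rw [← hab] at this
    exact_mod_cast this
  -- The outer thirds are `(b - a) / 3` apart, so no point is within `(b - a) / 6 > 2⁻ⁱ` of both in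
  -- the strict sense.
  obtain ⟨i, hi⟩ := exists_pow_lt_of_lt_one (show 0 < ((b : ℝ) - a) / 6 by linarith)
    (show (1 / 2 : ℝ) < 1 by norm_num)
  have hev : ∀ᶠ t in 𝓝 s, t ∈ U ∧ R t i = R s i := by
    have hUs := hU.mem_nhds hN
    filter_upwards [hUs, (hR.continuousAt hUs).eventually (eventually_apply_eq (R s) i)]
      with t h1 h2 using ⟨h1, h2⟩
  obtain ⟨M, ⟨⟨hM1, hM2⟩, hNM⟩⟩ := ((((tendsto_truncateWith s 1).eventually hev).and
    ((tendsto_truncateWith s 2).eventually hev)).and (eventually_ge_atTop N)).exists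
  have hsM : nestedThirds s M = (a, b) := by rw [hs, nestedThirds_truncateWith_zero s₀ hNM, hab]
  obtain ⟨x, hx, hxn⟩ := h _ hM1.1
  obtain ⟨y, hy, hyn⟩ := h _ hM2.1
  have hx2 := (hx (M + 1)).2
  have hy1 := (hy (M + 1)).1
  rw [nestedThirds_truncateWith_succ, hsM] at hx2 hy1
  simp at hx2 hy1
  have dx := unitInterval.dist_le_of_isName hxn i
  have dy := unitInterval.dist_le_of_isName hyn i
  rw [hM1.2] at dx
  rw [hM2.2] at dy
  have dxy := dist_triangle_left x y (unitIntervalSeq (R s i))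
  rw [Subtype.dist_eq, Real.dist_eq, abs_sub_comm] at dxy
  have := le_abs_self ((y : ℝ) - x)
  linarith

/-! ### Baire category argument -/

/-- A function on Baire space whose values are computed by a partial recursive functional along a
continuous family of oracles is continuous. -/
theorem PartrecFunctional.continuousOn {Φ : BaireSeq → ℕ →. ℕ} (hΦ : PartrecFunctional Φ)
    {T : Type*} [TopologicalSpace T] {U : Set T} {P R : T → BaireSeq}
    (hP : Continuous P) (hR : ∀ t ∈ U, ∀ n, R t n ∈ Φ (P t) n) : ContinuousOn R U := by
  intro t ht
  refine tendsto_pi_nhds.mpr fun n => tendsto_const_nhds.congr' ?_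
  have h1 := (hP.tendsto t).eventually (hΦ.eventually_mem (hR t ht n))
  filter_upwards [mem_nhdsWithin_of_mem_nhds h1, self_mem_nhdsWithin] with t' h2 h3
  exact Part.mem_unique h2 (hR t' h3 n)

/-- Interval choice is not reducible to discrete choice. -/
theorem not_intervalChoice_le_discreteChoice :
    ¬ WeihrauchReducible intervalChoice discreteChoice := by
  intro hred
  obtain ⟨Φ, Ψ, hΦ, hΨ, h⟩ := hred.exists_functionals
  have hs := fun s : ℕ → Fin 3 => h _ _ (isName_nestedThirdsName s) (by
    obtain ⟨a, b, hle, heq⟩ := nestedThirdsInter_eq_Icc s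
    refine ⟨a, ⟨a, b, hle, heq⟩, ?_⟩
    rw [← SetLike.mem_coe, heq]
    exact Set.left_mem_Icc.mpr hle)
  choose k A hk hA hne hH using hs
  have hkc : Continuous k := continuousOn_univ.mp
    (hΨ.continuousOn continuous_nestedThirdsName fun s _ => hk s)
  -- Negative information excludes `n` at a finite stage, which is an open condition on `s`.
  have hclosed : ∀ n, IsClosed {s | n ∈ A s} := by
    intro n
    have : {s | n ∈ A s} = ⋂ j, {s | k s j ≠ n + 1} := by
      ext s
      have := hA s n
      simp only [Set.mem_ofPred_eq, Set.mem_iInter]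
      rw [← not_exists, ← this, not_not]
    rw [this]
    exact isClosed_iInter fun j =>
      (isClosed_discrete {m : ℕ | m ≠ n + 1}).preimage ((continuous_apply j).comp hkc)
  have hcover : ⋃ n, {s | n ∈ A s} = Set.univ := by
    refine Set.eq_univ_of_forall fun s => ?_
    obtain ⟨n, -, hn⟩ := hne s
    exact Set.mem_iUnion.mpr ⟨n, hn⟩
  obtain ⟨n, hn⟩ := nonempty_interior_of_iUnion_of_closed hclosed hcover
  have hsol : ∀ s, ∃ r : BaireSeq, s ∈ interior {s | n ∈ A s} →
      (∀ i, r i ∈ Φ (bairePair (nestedThirdsName s) fun _ => n) i) ∧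
        ∃ x ∈ nestedThirdsInter s, IsName r x := by
    intro s
    by_cases hsn : s ∈ interior {s | n ∈ A s}
    · have hnA : s ∈ {s | n ∈ A s} := interior_subset hsn
      obtain ⟨r, x, hr, hx, hrx⟩ := hH s n ⟨⟨n, hnA⟩, hnA⟩ _ rfl
      exact ⟨r, fun _ => ⟨hr, x, hx.2, hrx⟩⟩
    · exact ⟨0, fun hc => absurd hc hsn⟩
  choose R hR using hsol
  have hP : Continuous fun s => bairePair (nestedThirdsName s) fun _ => n :=
    continuous_iff_continuousAt.mpr fun s =>
      tendsto_bairePair (continuous_nestedThirdsName.tendsto s) tendsto_const_nhds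
  exact not_continuous_intervalChoice isOpen_interior hn
    (hΦ.continuousOn hP fun s hs => (hR s hs).1) fun s hs => (hR s hs).2

/-- Interval choice is not Weihrauch reducible to discrete choice, and, moreover, discrete choice is
not Weihrauch reducible to interval choice: the two are incomparable. -/
theorem mainTheorem9 :
    ¬ WeihrauchReducible intervalChoice discreteChoice ∧
      ¬ WeihrauchReducible discreteChoice intervalChoice :=
  ⟨not_intervalChoice_le_discreteChoice, not_discreteChoice_le_intervalChoice⟩
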